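/- Let $K$ be a field, $n\ge 3$, and let $X=(x_{ij})$, $Y=(y_{ij})$ be $n\times n$ matrices of indeterminates. Let $R=K[x_{ij},y_{ij} : 1\le i,j\le n]$ with its standard grading, and let $I\subseteq R$ be the ideal generated by the diagonal entries of the commutator matrix $XY-YX$. Then the images in $R/I$ of the elements $$x_{11};\qquad x_{ij}\ (2\le i\le n,\ 1\le j\le n);\qquad y_{ij}\ (1\le i\le n,\ 2\le j\le n);\qquad x_{1j}-y_{j1}\ (1\le j\le n)$$ form a homogeneous system of parameters of $R/I$ (they are homogeneous of positive degree, their number, $2n^2-n+1$, equals the Krull dimension of $R/I$, and the quotient of $R/I$ by the ideal they generate has Krull dimension $0$), and, in any order, they form a regular sequence on $R/I$. Moreover, the quotient of $R/I$ by the ideal generated by these elements is isomorphic as a $K$-algebra to $$K[x_{12},\dots,x_{1n}]/(x_{12}^2,\dots,x_{1n}^2),$$ by an isomorphism that sends the class of $x_{1j}$ to the class of $x_{1j}$ for $2\le j\le n$. -/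

import Mathlib

noncomputable section

namespace CommDiag

open MvPolynomial

/-- The variables `x_{ij}` (left summand) and `y_{ij}` (right summand); indices run over `Fin n`, so
the index `0` plays the role of the usual index `1`. -/
abbrev Vars (n : ℕ) : Type := (Fin n × Fin n) ⊕ (Fin n × Fin n)

/-- The polynomial ring `R = K[X, Y]` in the entries of two `n × n` matrices. -/
abbrev PolyRing (n : ℕ) (K : Type*) [Field K] : Type _ := MvPolynomial (Vars n) K

/-- The generic matrix `X = (x_{ij})`. -/
def matX (n : ℕ) (K : Type*) [Field K] : Matrix (Fin n) (Fin n) (PolyRing n K) :=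
  Matrix.of fun i j => X (Sum.inl (i, j))

/-- The generic matrix `Y = (y_{ij})`. -/
def matY (n : ℕ) (K : Type*) [Field K] : Matrix (Fin n) (Fin n) (PolyRing n K) :=
  Matrix.of fun i j => X (Sum.inr (i, j))

/-- The commutator matrix `C = XY - YX`. -/
def commutator (n : ℕ) (K : Type*) [Field K] : Matrix (Fin n) (Fin n) (PolyRing n K) :=
  matX n K * matY n K - matY n K * matX n K

/-- The ideal `I` generated by the diagonal entries of the commutator matrix. -/
def diagIdeal (n : ℕ) (K : Type*) [Field K] : Ideal (PolyRing n K) :=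
  Ideal.span (Set.range fun i : Fin n => commutator n K i i)

/-- The coordinate ring `R/I`. -/
abbrev CoordRing (n : ℕ) (K : Type*) [Field K] : Type _ := PolyRing n K ⧸ diagIdeal n K

/-- The generators of `I` are forms of degree two, so `R/I` inherits the standard grading. -/
theorem commutator_diag_isHomogeneous (n : ℕ) (K : Type*) [Field K] (i : Fin n) :
    (commutator n K i i).IsHomogeneous 2 := by
  simp only [commutator, Matrix.sub_apply, Matrix.mul_apply, matX, matY, Matrix.of_apply]
  exact (IsHomogeneous.sum _ _ _ fun j _ => (isHomogeneous_X K _).mul (isHomogeneous_X K _)).sub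
    (IsHomogeneous.sum _ _ _ fun j _ => (isHomogeneous_X K _).mul (isHomogeneous_X K _))

/-- The grading of `R/I` induced by the standard grading of `R`: its piece of degree `d` is the
image of the forms of degree `d`. -/
def grading (n : ℕ) (K : Type*) [Field K] (d : ℕ) : Submodule K (CoordRing n K) :=
  (homogeneousSubmodule (Vars n) K d).map (Ideal.Quotient.mkₐ K (diagIdeal n K)).toLinearMap

/-- For a `K`-algebra `A` graded by `𝒜` (in degrees `ℕ`, with `𝒜 0 = K`), a finite family `f` of
elements of `A` is a homogeneous system of parameters if its members are homogeneous of positive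
degree, their number is the Krull dimension of `A`, and `A/(f)` has Krull dimension zero. -/
structure IsHomogeneousSOP {K A : Type*} [Field K] [CommRing A] [Algebra K A]
    (𝒜 : ℕ → Submodule K A) {ι : Type*} [Fintype ι] (f : ι → A) : Prop where
  homogeneous : ∀ i, ∃ d, 0 < d ∧ f i ∈ 𝒜 d
  card_eq_dim : ringKrullDim A = (Fintype.card ι : WithBot ℕ∞)
  quotient_dim : ringKrullDim (A ⧸ Ideal.span (Set.range f)) = 0

/-- A finite family is a regular sequence on `A` in whichever order its members are listed. -/
def IsRegularFamily (A : Type*) [CommRing A] {ι : Type*} (f : ι → A) : Prop :=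
  ∀ l : List ι, l.Nodup → (∀ i, i ∈ l) → RingTheory.Sequence.IsRegular A (l.map f)

/-- Index set of the system of parameters: one index for `x_{11}`, the positions `(i, j)` with
`i ≥ 2`, the positions `(i, j)` with `j ≥ 2`, and the indices `1 ≤ j ≤ n`. -/
abbrev ParamIndex (n : ℕ) [NeZero n] : Type :=
  Unit ⊕ {p : Fin n × Fin n // p.1 ≠ 0} ⊕ {p : Fin n × Fin n // p.2 ≠ 0} ⊕ Fin n

/-- The elements `x_{11}`; `x_{ij}` with `i ≥ 2`; `y_{ij}` with `j ≥ 2`; `x_{1j} - y_{j1}`. -/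
def param (n : ℕ) [NeZero n] (K : Type*) [Field K] : ParamIndex n → PolyRing n K
  | Sum.inl _ => matX n K 0 0
  | Sum.inr (Sum.inl p) => matX n K p.1.1 p.1.2
  | Sum.inr (Sum.inr (Sum.inl p)) => matY n K p.1.1 p.1.2
  | Sum.inr (Sum.inr (Sum.inr j)) => matX n K 0 j - matY n K j 0

/-- The images of these elements in `R/I`. -/
def paramBar (n : ℕ) [NeZero n] (K : Type*) [Field K] (s : ParamIndex n) : CoordRing n K :=
  Ideal.Quotient.mk (diagIdeal n K) (param n K s)

/-- The quotient of `R/I` by the ideal generated by these elements. -/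
abbrev ParamQuotient (n : ℕ) [NeZero n] (K : Type*) [Field K] : Type _ :=
  CoordRing n K ⧸ Ideal.span (Set.range (paramBar n K))

/-- The ring `K[x_{12}, …, x_{1n}]/(x_{12}², …, x_{1n}²)`. -/
abbrev SquareZeroRing (n : ℕ) [NeZero n] (K : Type*) [Field K] : Type _ :=
  MvPolynomial {j : Fin n // j ≠ 0} K ⧸
    Ideal.span (Set.range fun j : {j : Fin n // j ≠ 0} =>
      (X j ^ 2 : MvPolynomial {j : Fin n // j ≠ 0} K))

end CommDiag

end

/-! Let P be the polynomial ring on the listed parameters, mapped to R/I. Over P the only new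
generators are t_j = x_{1j} for j ≥ 2, since y_{j1} = x_{1j} - (x_{1j} - y_{j1}). For j ≥ 2 the j-th
diagonal entry of XY - YX has just one product outside P, namely -y_{j1}x_{1j}, so its vanishing is
a monic quadratic equation for t_j alone: t_j² = f_j t_j + d_j, with f_j = x_{1j} - y_{j1} and d_j
in P. The equation for j = 1 is redundant because a commutator has trace zero. Hence R/I is P with
one root of each monic quadratic adjoined (`coordRingEquiv`), so it is finite free and nonzero over
P, hence faithfully flat and integral. Regularity of the variables of P therefore passes to R/I
(`isRegularFamily_paramBar`), and dim R/I = dim P (`ringKrullDim_coordRing`). Setting all parameters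
to zero turns the equations into t_j² = 0 (`paramQuotientEquiv`), leaving a finite-dimensional
algebra. -/

namespace MvPolynomial

/-! ### Variables as a regular sequence -/

/-- Membership is tested monomial by monomial: multiplication by `X a` shifts exponents only at `a`,
so a variable of `s` dividing the shifted monomial already divides the original one. -/
theorem X_mul_mem_span_X_image {σ R : Type*} [CommRing R] {s : Set σ} {a : σ} (ha : a ∉ s)
    {f : MvPolynomial σ R} (h : X a * f ∈ Ideal.span (X '' s : Set (MvPolynomial σ R))) :
    f ∈ Ideal.span (X '' s : Set (MvPolynomial σ R)) := by
  rw [mem_ideal_span_X_image] at h ⊢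
  intro m hm
  obtain ⟨i, hi, hne⟩ := h (Finsupp.single a 1 + m) (by
    rwa [mem_support_iff, coeff_X_mul, ← mem_support_iff])
  refine ⟨i, hi, ?_⟩
  have hia : a ≠ i := fun h => ha (h ▸ hi)
  simpa [Finsupp.single_apply, hia] using hne

theorem isRegular_map_X {σ R : Type*} [CommRing R] [Nontrivial R] {l : List σ} (hl : l.Nodup) :
    RingTheory.Sequence.IsRegular (MvPolynomial σ R) (l.map (X : σ → MvPolynomial σ R)) := by
  have hspan (l : List σ) : (Ideal.ofList (l.map (X : σ → MvPolynomial σ R)) • ⊤ :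
      Submodule (MvPolynomial σ R) (MvPolynomial σ R)) =
      Ideal.span (X '' {i | i ∈ l} : Set (MvPolynomial σ R)) := by
    rw [smul_eq_mul, Ideal.mul_top, Ideal.ofList]
    congr 1
    ext; simp
  refine ⟨⟨fun i hi => ?_⟩, fun h => ?_⟩
  · rw [← List.map_take, hspan, isSMulRegular_iff_right_eq_zero_of_smul]
    intro x hx
    obtain ⟨f, rfl⟩ := Submodule.Quotient.mk_surjective _ x
    rw [← Submodule.Quotient.mk_smul, Submodule.Quotient.mk_eq_zero, smul_eq_mul,
      List.getElem_map] at hx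
    rw [Submodule.Quotient.mk_eq_zero]
    refine X_mul_mem_span_X_image (fun hmem => ?_) hx
    obtain ⟨j, hj, hji⟩ := List.mem_take_iff_getElem.mp hmem
    have := (List.Nodup.getElem_inj_iff hl).mp hji
    omega
  -- The ideal is proper: no variable divides the monomial of 1.
  · rw [hspan] at h
    have h1 : (1 : MvPolynomial σ R) ∈ Ideal.span (X '' {i | i ∈ l}) := h ▸ Submodule.mem_top
    obtain ⟨i, -, hi⟩ := mem_ideal_span_X_image.mp h1 0 (by simp)
    exact hi rfl

end MvPolynomial

/-! ### Krull dimension of integral faithfully flat extensions -/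

/-- Integrality gives incomparability, so strict chains contract to strict chains. Conversely,
faithful flatness provides a prime over the top of a given chain, and going down lifts the rest of
it. -/
theorem ringKrullDim_eq_of_isIntegral_of_faithfullyFlat (A B : Type*) [CommRing A] [CommRing B]
    [Algebra A B] [Algebra.IsIntegral A B] [Module.FaithfullyFlat A B] :
    ringKrullDim B = ringKrullDim A := by
  refine le_antisymm ?_ ?_
  · exact Order.krullDim_le_of_strictMono (PrimeSpectrum.comap (algebraMap A B))
      fun p q h => Ideal.IsIntegral.comap_lt_comap (R := A) h
  · refine iSup_le fun l => ?_
    obtain ⟨Q, hQ⟩ := PrimeSpectrum.comap_surjective_of_faithfullyFlat (B := B) (RelSeries.last l)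
    have : Q.asIdeal.LiesOver (RelSeries.last l).asIdeal := ⟨by rw [← hQ]; rfl⟩
    obtain ⟨L, hL, -⟩ := Ideal.exists_ltSeries_of_hasGoingDown l Q.asIdeal
    rw [← hL]
    exact Order.LTSeries.length_le_krullDim L

/-! ### Adjoining roots of univariate equations -/

namespace MvPolynomial

/-- The ideal generated by one univariate polynomial in each of the variables. -/
noncomputable abbrev univariateIdeal {ι A : Type*} [CommRing A] (p : ι → Polynomial A) :
    Ideal (MvPolynomial ι A) :=
  Ideal.span (Set.range fun i => Polynomial.aeval (X i) (p i))

theorem aeval_mk_X_univariateIdeal {ι A : Type*} [CommRing A] (p : ι → Polynomial A) (i : ι) :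
    Polynomial.aeval (Ideal.Quotient.mk (univariateIdeal p) (X i)) (p i) = 0 := by
  rw [← Ideal.Quotient.mkₐ_eq_mk A, Polynomial.aeval_algHom_apply, Ideal.Quotient.mkₐ_eq_mk,
    Ideal.Quotient.eq_zero_iff_mem]
  exact Ideal.subset_span ⟨i, rfl⟩

/-- The universal property of the quotient by univariate equations. -/
noncomputable def univariateLift {ι A B : Type*} [CommRing A] [CommRing B] [Algebra A B]
    (p : ι → Polynomial A) (b : ι → B) (hb : ∀ i, Polynomial.aeval (b i) (p i) = 0) :
    (MvPolynomial ι A ⧸ univariateIdeal p) →ₐ[A] B :=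
  Ideal.Quotient.liftₐ _ (aeval b) fun a ha => by
    have : univariateIdeal p ≤ RingHom.ker (aeval b : MvPolynomial ι A →ₐ[A] B) := by
      rw [Ideal.span_le]
      rintro _ ⟨i, rfl⟩
      simp [RingHom.mem_ker, ← Polynomial.aeval_algHom_apply, hb]
    exact this ha

@[simp]
theorem univariateLift_mk_X {ι A B : Type*} [CommRing A] [CommRing B] [Algebra A B]
    (p : ι → Polynomial A) (b : ι → B) (hb : ∀ i, Polynomial.aeval (b i) (p i) = 0) (i : ι) :
    univariateLift p b hb (Ideal.Quotient.mk _ (X i)) = b i :=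
  (Ideal.Quotient.lift_mk _ _ _).trans (aeval_X _ _)

theorem univariate_algHom_ext {ι A B : Type*} [CommRing A] [CommRing B] [Algebra A B]
    {p : ι → Polynomial A} {f g : (MvPolynomial ι A ⧸ univariateIdeal p) →ₐ[A] B}
    (h : ∀ i, f (Ideal.Quotient.mk _ (X i)) = g (Ideal.Quotient.mk _ (X i))) : f = g := by
  refine Ideal.Quotient.algHom_ext _ (algHom_ext fun i => ?_)
  simpa using h i

/-- Reindexing the variables of the quotient by univariate equations. -/
noncomputable def univariateReindex {ι κ A : Type*} [CommRing A] (e : ι ≃ κ)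
    (p : κ → Polynomial A) :
    (MvPolynomial ι A ⧸ univariateIdeal (p ∘ e)) ≃ₐ[A] (MvPolynomial κ A ⧸ univariateIdeal p) :=
  AlgEquiv.ofAlgHom
    (univariateLift _ (fun i => Ideal.Quotient.mk _ (X (e i)))
      fun i => aeval_mk_X_univariateIdeal p (e i))
    (univariateLift _ (fun k => Ideal.Quotient.mk _ (X (e.symm k))) fun k => by
      simpa using aeval_mk_X_univariateIdeal (p ∘ e) (e.symm k))
    (univariate_algHom_ext fun i => by simp) (univariate_algHom_ext fun i => by simp)

/-- Adjoining the variables of `Option ι` one after the other. -/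
noncomputable def univariateOption {ι A : Type*} [CommRing A] (p : Option ι → Polynomial A) :
    (MvPolynomial (Option ι) A ⧸ univariateIdeal p) ≃ₐ[A]
      AdjoinRoot ((p none).map
        (algebraMap A (MvPolynomial ι A ⧸ univariateIdeal fun i => p (some i)))) :=
  AlgEquiv.ofAlgHom
    (univariateLift p
      (fun o => o.elim (AdjoinRoot.root _)
        fun i => AdjoinRoot.of _ (Ideal.Quotient.mk _ (X i))) (by
      rintro (_ | i)
      · have := AdjoinRoot.eval₂_root ((p none).map
          (algebraMap A (MvPolynomial ι A ⧸ univariateIdeal fun i => p (some i))))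
        rwa [Polynomial.eval₂_map] at this
      · have := congrArg (AdjoinRoot.of ((p none).map
          (algebraMap A (MvPolynomial ι A ⧸ univariateIdeal fun i => p (some i)))))
            (aeval_mk_X_univariateIdeal (fun i => p (some i)) i)
        rw [map_zero, ← AdjoinRoot.algebraMap_eq, ← Polynomial.aeval_algebraMap_apply] at this
        exact this))
    (AdjoinRoot.liftAlgHom _
      (univariateLift (fun i => p (some i)) (fun i => Ideal.Quotient.mk _ (X (some i)))
        fun i => aeval_mk_X_univariateIdeal p (some i))
      (Ideal.Quotient.mk _ (X none)) (by
        rw [Polynomial.eval₂_map]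
        rw [← aeval_mk_X_univariateIdeal p none, Polynomial.aeval_def]
        exact congrArg (fun f => Polynomial.eval₂ f _ _) (AlgHom.comp_algebraMap _)))
    (by
      refine AdjoinRoot.algHom_ext' (univariate_algHom_ext fun i => ?_) ?_
      · simp
      · simp)
    (univariate_algHom_ext fun i => by cases i <;> simp)

/-- Each variable adjoins a root of a monic polynomial, a finite free extension; such extensions
compose. -/
theorem free_and_finite_quotient_univariateIdeal {ι A : Type*} [Finite ι] [CommRing A]
    (p : ι → Polynomial A) (hp : ∀ i, (p i).Monic) :
    Module.Free A (MvPolynomial ι A ⧸ univariateIdeal p) ∧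
      Module.Finite A (MvPolynomial ι A ⧸ univariateIdeal p) := by
  induction ι using Finite.induction_empty_option with
  | of_equiv e ih =>
    obtain ⟨_, _⟩ := ih (p ∘ e) fun i => hp _
    exact ⟨.of_equiv (univariateReindex e p).toLinearEquiv,
      .equiv (univariateReindex e p).toLinearEquiv⟩
  | h_empty =>
    have hbot : univariateIdeal p = ⊥ := by simp [univariateIdeal, Set.range_eq_empty]
    let e : (MvPolynomial PEmpty A ⧸ univariateIdeal p) ≃ₐ[A] A :=
      ((Ideal.quotientEquivAlgOfEq A hbot).trans (AlgEquiv.quotientBot A _)).trans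
        (isEmptyAlgEquiv A PEmpty)
    exact ⟨.of_equiv e.symm.toLinearEquiv, .equiv e.symm.toLinearEquiv⟩
  | h_option ih =>
    obtain ⟨_, _⟩ := ih (fun i => p (some i)) fun i => hp _
    let B := MvPolynomial _ A ⧸ univariateIdeal fun i => p (some i)
    let C := AdjoinRoot ((p none).map (algebraMap A B))
    have hm := (hp none).map (algebraMap A B)
    have : Module.Free B C := hm.free_adjoinRoot
    have : Module.Finite B C := hm.finite_adjoinRoot
    have : Module.Free A C := .trans (S := B)
    have : Module.Finite A C := .trans B C
    exact ⟨.of_equiv (univariateOption p).symm.toLinearEquiv,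
      .equiv (univariateOption p).symm.toLinearEquiv⟩

end MvPolynomial

namespace CommDiag

open MvPolynomial

variable {n : ℕ} [NeZero n]

/-! ### Diagonal entries of the commutator in terms of the parameters -/

section Matrices

variable {S : Type*} [CommRing S]

/-- The first matrix with the entries outside the first row prescribed by `f`, and first row `0`. -/
def lowerX (f : ParamIndex n → S) : Matrix (Fin n) (Fin n) S :=
  Matrix.of fun i j => if h : i ≠ 0 then f (Sum.inr (Sum.inl ⟨(i, j), h⟩)) else 0

/-- The second matrix with the entries outside the first column prescribed by `f`, and first
column `0`. -/
def lowerY (f : ParamIndex n → S) : Matrix (Fin n) (Fin n) S :=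
  Matrix.of fun i j => if h : j ≠ 0 then f (Sum.inr (Sum.inr (Sum.inl ⟨(i, j), h⟩))) else 0

/-- The part of the diagonal entries of the commutator which involves only the parameters. -/
def paramDiag (f : ParamIndex n → S) (i : Fin n) : S :=
  (lowerX f * lowerY f - lowerY f * lowerX f) i i

/-- The first matrix with parameters `f` and remaining entries `t`. -/
def pointX (f : ParamIndex n → S) (t : {j : Fin n // j ≠ 0} → S) : Matrix (Fin n) (Fin n) S :=
  Matrix.of fun i j =>
    if h : i ≠ 0 then f (Sum.inr (Sum.inl ⟨(i, j), h⟩))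
    else if h : j ≠ 0 then t ⟨j, h⟩ else f (Sum.inl ())

/-- The second matrix with parameters `f`, where `t` lists the remaining entries of the first. -/
def pointY (f : ParamIndex n → S) (t : {j : Fin n // j ≠ 0} → S) : Matrix (Fin n) (Fin n) S :=
  Matrix.of fun i j =>
    if h : j ≠ 0 then f (Sum.inr (Sum.inr (Sum.inl ⟨(i, j), h⟩)))
    else pointX f t 0 i - f (Sum.inr (Sum.inr (Sum.inr i)))

theorem commutator_point_apply_self (f : ParamIndex n → S) (t : {j : Fin n // j ≠ 0} → S)
    (j : {j : Fin n // j ≠ 0}) :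
    (pointX f t * pointY f t - pointY f t * pointX f t) j.1 j.1 =
      paramDiag f j.1 - (t j - f (Sum.inr (Sum.inr (Sum.inr j.1)))) * t j := by
  obtain ⟨i, hi⟩ := j
  -- Row i of the first matrix and column i of the second consist of parameters, as i ≠ 0.
  have h1 : (pointX f t * pointY f t) i i = (lowerX f * lowerY f) i i := by
    simp only [Matrix.mul_apply]
    refine Finset.sum_congr rfl fun k _ => ?_
    simp [pointX, pointY, lowerX, lowerY, hi]
  -- Only the summand k = 0 leaves the parameters.
  have h2 : (pointY f t * pointX f t) i i - (lowerY f * lowerX f) i i =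
      pointY f t i 0 * pointX f t 0 i := by
    simp only [Matrix.mul_apply, ← Finset.sum_sub_distrib]
    rw [Finset.sum_eq_single 0]
    · simp [lowerX]
    · intro k _ hk
      simp [pointX, pointY, lowerX, lowerY, hk]
    · simp
  have h3 : pointX f t 0 i = t ⟨i, hi⟩ := by simp [pointX, hi]
  have h4 : pointY f t i 0 = t ⟨i, hi⟩ - f (Sum.inr (Sum.inr (Sum.inr i))) := by
    simp [pointY, h3]
  rw [h3, h4] at h2
  simp only [paramDiag, Matrix.sub_apply, h1]
  linear_combination -h2

/-- The quadratic equations kill every diagonal entry but the first, which then vanishes with the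
trace. -/
theorem commutator_point_apply_self_eq_zero {f : ParamIndex n → S}
    {t : {j : Fin n // j ≠ 0} → S}
    (h : ∀ j, t j ^ 2 = f (Sum.inr (Sum.inr (Sum.inr j.1))) * t j + paramDiag f j.1) (i : Fin n) :
    (pointX f t * pointY f t - pointY f t * pointX f t) i i = 0 := by
  have key (i : Fin n) (hi : i ≠ 0) :
      (pointX f t * pointY f t - pointY f t * pointX f t) i i = 0 := by
    rw [commutator_point_apply_self f t ⟨i, hi⟩]
    linear_combination -h ⟨i, hi⟩
  by_cases hi : i = 0
  · have htr : ∑ k, (pointX f t * pointY f t - pointY f t * pointX f t) k k = 0 := by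
      change (pointX f t * pointY f t - pointY f t * pointX f t).trace = 0
      rw [Matrix.trace_sub, Matrix.trace_mul_comm, sub_self]
    rw [Finset.sum_eq_single 0 (fun k _ hk => key k hk)
      fun h => absurd (Finset.mem_univ _) h] at htr
    exact hi ▸ htr
  · exact key i hi

theorem map_paramDiag {T : Type*} [CommRing T] (φ : S →+* T) (f : ParamIndex n → S) (i : Fin n) :
    paramDiag (φ ∘ f) i = φ (paramDiag f i) := by
  have hX : lowerX (φ ∘ f) = φ.mapMatrix (lowerX f) := by
    ext a b; by_cases h : a = 0 <;> simp [lowerX, h]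
  have hY : lowerY (φ ∘ f) = φ.mapMatrix (lowerY f) := by
    ext a b; by_cases h : b = 0 <;> simp [lowerY, h]
  simp only [paramDiag, hX, hY, ← map_mul, ← map_sub]
  rfl

theorem paramDiag_zero (i : Fin n) :
    paramDiag (0 : ParamIndex n → S) i = 0 := by
  have hX : lowerX (0 : ParamIndex n → S) = 0 := by ext; simp [lowerX]
  simp [paramDiag, hX]

theorem paramDiag_mem {J : Ideal S} {f : ParamIndex n → S} (h : ∀ s, f s ∈ J) (i : Fin n) :
    paramDiag f i ∈ J := by
  have hX (a b) : lowerX f a b ∈ J := by by_cases ha : a = 0 <;> simp [lowerX, ha, h]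
  rw [paramDiag, Matrix.sub_apply, Matrix.mul_apply, Matrix.mul_apply]
  exact sub_mem (J.sum_mem fun _ _ => J.mul_mem_right _ (hX _ _))
    (J.sum_mem fun _ _ => J.mul_mem_left _ (hX _ _))

end Matrices

/-! ### Homomorphisms out of the coordinate ring -/

variable {K : Type*} [Field K]

/-- The homomorphism from the coordinate ring given by a solution of the quadratic equations. -/
noncomputable def pointHom {S : Type*} [CommRing S] [Algebra K S] (f : ParamIndex n → S)
    (t : {j : Fin n // j ≠ 0} → S)
    (h : ∀ j, t j ^ 2 = f (Sum.inr (Sum.inr (Sum.inr j.1))) * t j + paramDiag f j.1) :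
    CoordRing n K →ₐ[K] S :=
  Ideal.Quotient.liftₐ _
    (aeval (Sum.elim (fun p => pointX f t p.1 p.2) fun p => pointY f t p.1 p.2)) (by
      set φ : PolyRing n K →ₐ[K] S :=
        aeval (Sum.elim (fun p => pointX f t p.1 p.2) fun p => pointY f t p.1 p.2)
      suffices diagIdeal n K ≤ RingHom.ker φ from fun a ha => this ha
      rw [diagIdeal, Ideal.span_le]
      rintro _ ⟨i, rfl⟩
      rw [SetLike.mem_coe, RingHom.mem_ker, ← commutator_point_apply_self_eq_zero h i]
      simp [φ, commutator, Matrix.mul_apply, matX, matY])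

section PointHom

variable {S : Type*} [CommRing S] [Algebra K S] {f : ParamIndex n → S}
  {t : {j : Fin n // j ≠ 0} → S}
  (h : ∀ j, t j ^ 2 = f (Sum.inr (Sum.inr (Sum.inr j.1))) * t j + paramDiag f j.1)

@[simp]
theorem pointHom_matX (i j : Fin n) :
    pointHom (K := K) f t h (Ideal.Quotient.mk _ (matX n K i j)) = pointX f t i j :=
  (Ideal.Quotient.lift_mk _ _ _).trans (aeval_X _ _)

@[simp]
theorem pointHom_matY (i j : Fin n) :
    pointHom (K := K) f t h (Ideal.Quotient.mk _ (matY n K i j)) = pointY f t i j :=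
  (Ideal.Quotient.lift_mk _ _ _).trans (aeval_X _ _)

@[simp]
theorem pointHom_paramBar (s : ParamIndex n) : pointHom (K := K) f t h (paramBar n K s) = f s := by
  rcases s with _ | ⟨⟨i, j⟩, hp⟩ | ⟨⟨i, j⟩, hp⟩ | j
  · simp [paramBar, param, pointX]
  · have hp' : i ≠ 0 := hp
    simp [paramBar, param, pointX, hp']
  · have hp' : j ≠ 0 := hp
    simp [paramBar, param, pointY, hp']
  · simp [paramBar, param, pointY]

end PointHom

theorem coordRing_algHom_ext {S : Type*} [CommRing S] [Algebra K S] {φ ψ : CoordRing n K →ₐ[K] S}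
    (hf : ∀ s, φ (paramBar n K s) = ψ (paramBar n K s))
    (ht : ∀ j : {j : Fin n // j ≠ 0}, φ (Ideal.Quotient.mk _ (matX n K 0 j.1)) =
      ψ (Ideal.Quotient.mk _ (matX n K 0 j.1))) : φ = ψ := by
  have hX (i j : Fin n) : φ (Ideal.Quotient.mk _ (matX n K i j)) =
      ψ (Ideal.Quotient.mk _ (matX n K i j)) := by
    by_cases hi : i = 0
    · subst hi
      by_cases hj : j = 0
      · subst hj; exact hf (Sum.inl ())
      · exact ht ⟨j, hj⟩
    · exact hf (Sum.inr (Sum.inl ⟨(i, j), hi⟩))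
  refine Ideal.Quotient.algHom_ext _ (algHom_ext ?_)
  rintro (⟨i, j⟩ | ⟨i, j⟩)
  · exact hX i j
  · by_cases hj : j = 0
    · subst hj
      -- The entry y_{i1} is recovered from x_{1i} and the parameter x_{1i} - y_{i1}.
      have := hf (Sum.inr (Sum.inr (Sum.inr i)))
      simp only [paramBar, param, map_sub, hX, sub_right_inj] at this
      exact this
    · exact hf (Sum.inr (Sum.inr (Sum.inl ⟨(i, j), hj⟩)))

variable (n K) in
/-- The images in the coordinate ring of the entries of the first row of the first matrix,
except for the first entry. -/
noncomputable def rowBar (j : {j : Fin n // j ≠ 0}) : CoordRing n K :=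
  Ideal.Quotient.mk _ (matX n K 0 j.1)

variable (n K) in
theorem rowBar_sq (j : {j : Fin n // j ≠ 0}) :
    rowBar n K j ^ 2 = paramBar n K (Sum.inr (Sum.inr (Sum.inr j.1))) * rowBar n K j +
      paramDiag (paramBar n K) j.1 := by
  have hX : pointX (paramBar n K) (rowBar n K) =
      (Ideal.Quotient.mk (diagIdeal n K)).mapMatrix (matX n K) := by
    ext a b
    by_cases ha : a = 0
    · by_cases hb : b = 0 <;> simp [pointX, ha, hb, rowBar, paramBar, param]
    · simp [pointX, ha, paramBar, param]
  have hY : pointY (paramBar n K) (rowBar n K) =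
      (Ideal.Quotient.mk (diagIdeal n K)).mapMatrix (matY n K) := by
    ext a b
    by_cases hb : b = 0 <;> simp [pointY, hX, hb, paramBar, param]
  have h := commutator_point_apply_self (paramBar n K) (rowBar n K) j
  rw [hX, hY, ← map_mul, ← map_mul, ← map_sub] at h
  have h0 : (Ideal.Quotient.mk (diagIdeal n K)).mapMatrix (commutator n K) j.1 j.1 = 0 :=
    Ideal.Quotient.eq_zero_iff_mem.mpr (Ideal.subset_span ⟨j.1, rfl⟩)
  rw [commutator, h] at h0
  linear_combination -h0

/-! ### Freeness over the polynomial ring in the parameters -/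

variable (n K) in
/-- The polynomial ring in the parameters. -/
abbrev ParamRing : Type _ := MvPolynomial (ParamIndex n) K

variable (n K) in
/-- The quadratic equation of an entry of the first row over the polynomial ring in the
parameters. -/
noncomputable def rowPoly (j : {j : Fin n // j ≠ 0}) : Polynomial (ParamRing n K) :=
  Polynomial.X ^ 2 - (Polynomial.C (X (Sum.inr (Sum.inr (Sum.inr j.1)))) * Polynomial.X +
    Polynomial.C (paramDiag X j.1))

theorem rowPoly_monic (j : {j : Fin n // j ≠ 0}) : (rowPoly n K j).Monic :=
  Polynomial.monic_X_pow_sub (n := 2)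
    (Polynomial.degree_linear_le.trans_lt (by norm_num))

theorem aeval_rowPoly_eq_zero_iff {S : Type*} [CommRing S] [Algebra (ParamRing n K) S]
    (j : {j : Fin n // j ≠ 0}) (b : S) :
    Polynomial.aeval b (rowPoly n K j) = 0 ↔
      b ^ 2 = algebraMap (ParamRing n K) S (X (Sum.inr (Sum.inr (Sum.inr j.1)))) * b +
        paramDiag (algebraMap (ParamRing n K) S ∘ X) j.1 := by
  simp [rowPoly, sub_eq_zero, map_paramDiag]

/-- The coordinate ring as an algebra over the polynomial ring in the parameters. -/
noncomputable instance paramAlgebra : Algebra (ParamRing n K) (CoordRing n K) :=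
  (aeval (paramBar n K) : ParamRing n K →ₐ[K] CoordRing n K).toAlgebra

noncomputable instance : Module (ParamRing n K) (CoordRing n K) := paramAlgebra.toModule

theorem algebraMap_X (s : ParamIndex n) :
    algebraMap (ParamRing n K) (CoordRing n K) (X s) = paramBar n K s :=
  aeval_X _ _

instance : IsScalarTower K (ParamRing n K) (CoordRing n K) :=
  .of_algebraMap_eq' (aeval (paramBar n K) : ParamRing n K →ₐ[K] CoordRing n K).comp_algebraMap.symm

variable (n K) in
/-- The coordinate ring is obtained from the polynomial ring in the parameters by adjoining one root
of each of the monic quadratic equations. -/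
noncomputable def coordRingEquiv :
    CoordRing n K ≃ₐ[ParamRing n K] (MvPolynomial {j : Fin n // j ≠ 0} (ParamRing n K) ⧸
      univariateIdeal (rowPoly n K)) :=
  let B := MvPolynomial {j : Fin n // j ≠ 0} (ParamRing n K) ⧸ univariateIdeal (rowPoly n K)
  let F : CoordRing n K →ₐ[K] B :=
    pointHom (algebraMap (ParamRing n K) B ∘ X) (fun j => Ideal.Quotient.mk _ (X j)) fun j =>
      (aeval_rowPoly_eq_zero_iff j _).mp (aeval_mk_X_univariateIdeal _ j)
  have hF : F.comp (aeval (paramBar n K)) = IsScalarTower.toAlgHom K (ParamRing n K) B :=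
    algHom_ext fun s => by simp [F]
  let F' : CoordRing n K →ₐ[ParamRing n K] B :=
    { F with commutes' := fun a => DFunLike.congr_fun hF a }
  let G : B →ₐ[ParamRing n K] CoordRing n K :=
    univariateLift _ (rowBar n K) fun j => (aeval_rowPoly_eq_zero_iff j _).mpr (by
      have : algebraMap (ParamRing n K) (CoordRing n K) ∘ X = paramBar n K := funext algebraMap_X
      rw [this, algebraMap_X, rowBar_sq])
  have hrow (j) : F' (rowBar n K j) = Ideal.Quotient.mk _ (X j) := by
    change F _ = _
    simp [F, rowBar, pointX, j.2]
  have hG (j) : G (Ideal.Quotient.mk _ (X j)) = rowBar n K j := univariateLift_mk_X _ _ _ _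
  -- The extensionality lemma concerns `K`-algebra maps, so scalars are restricted before comparing.
  have hGF : (G.restrictScalars K).comp (F'.restrictScalars K) = AlgHom.id K (CoordRing n K) :=
    coordRing_algHom_ext
      (fun s => by simp [← algebraMap_X])
      (fun j => by
        change G (F' (rowBar n K j)) = rowBar n K j
        rw [hrow, hG])
  AlgEquiv.ofAlgHom F' G
    (univariate_algHom_ext fun j => by simp [hG, hrow])
    (AlgHom.ext fun a => DFunLike.congr_fun hGF a)

instance : Module.Free (ParamRing n K) (CoordRing n K) :=
  have := (free_and_finite_quotient_univariateIdeal (rowPoly n K) rowPoly_monic).1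
  .of_equiv (coordRingEquiv n K).symm.toLinearEquiv

instance : Module.Finite (ParamRing n K) (CoordRing n K) :=
  have := (free_and_finite_quotient_univariateIdeal (rowPoly n K) rowPoly_monic).2
  .equiv (coordRingEquiv n K).symm.toLinearEquiv

/-- The pair of zero matrices is a `K`-point. Together with freeness this yields faithful flatness.
-/
instance : Nontrivial (CoordRing n K) :=
  (pointHom (K := K) (S := K) 0 0 fun j => by
    simp [paramDiag_zero]).toRingHom.domain_nontrivial

/-! ### Regularity, grading and dimension -/

variable (n K) in
theorem isRegularFamily_paramBar : IsRegularFamily (CoordRing n K) (paramBar n K) := by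
  intro l hl _
  have h := (isRegular_map_X (R := K) hl).of_faithfullyFlat (S := CoordRing n K)
  rw [List.map_map] at h
  rwa [show algebraMap (ParamRing n K) (CoordRing n K) ∘ X = paramBar n K from
    funext algebraMap_X] at h

theorem paramBar_mem_grading (s : ParamIndex n) : paramBar n K s ∈ grading n K 1 := by
  refine ⟨param n K s, ?_, rfl⟩
  rw [SetLike.mem_coe]
  rw [mem_homogeneousSubmodule]
  rcases s with _ | _ | _ | _
  · exact isHomogeneous_X K _
  · exact isHomogeneous_X K _
  · exact isHomogeneous_X K _
  · exact (isHomogeneous_X K _).sub (isHomogeneous_X K _)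

variable (n K) in
theorem ringKrullDim_coordRing :
    ringKrullDim (CoordRing n K) = (Fintype.card (ParamIndex n) : WithBot ℕ∞) := by
  rw [ringKrullDim_eq_of_isIntegral_of_faithfullyFlat (ParamRing n K),
    ringKrullDim_of_isNoetherianRing, ringKrullDim_eq_zero_of_field, zero_add,
    Nat.card_eq_fintype_card]

/-! ### The quotient by the parameters -/

variable (n K) in
/-- The ideal generated by the parameters. -/
noncomputable abbrev paramIdeal : Ideal (CoordRing n K) := Ideal.span (Set.range (paramBar n K))

theorem mk_paramBar (s : ParamIndex n) : Ideal.Quotient.mk (paramIdeal n K) (paramBar n K s) = 0 :=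
  Ideal.Quotient.eq_zero_iff_mem.mpr (Ideal.subset_span ⟨s, rfl⟩)

theorem mk_rowBar_sq (j : {j : Fin n // j ≠ 0}) :
    Ideal.Quotient.mk (paramIdeal n K) (rowBar n K j) ^ 2 = 0 := by
  rw [← map_pow, rowBar_sq, Ideal.Quotient.eq_zero_iff_mem]
  refine add_mem (Ideal.mul_mem_right _ _ (Ideal.subset_span ⟨_, rfl⟩)) ?_
  exact paramDiag_mem (J := paramIdeal n K) (fun s => Ideal.subset_span ⟨s, rfl⟩) _

variable (n K) in
/-- The homomorphism from the coordinate ring sending all parameters to zero. -/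
noncomputable def coordRingToSquareZero : CoordRing n K →ₐ[K] SquareZeroRing n K :=
  pointHom 0 (fun j => Ideal.Quotient.mk _ (X j)) fun j => by
    rw [paramDiag_zero, Pi.zero_apply, zero_mul, zero_add, ← map_pow]
    exact Ideal.Quotient.eq_zero_iff_mem.mpr (Ideal.subset_span ⟨j, rfl⟩)

theorem coordRingToSquareZero_rowBar (j : {j : Fin n // j ≠ 0}) :
    coordRingToSquareZero n K (rowBar n K j) = Ideal.Quotient.mk _ (X j) := by
  simp [coordRingToSquareZero, rowBar, pointX, j.2]

variable (n K) in
/-- The homomorphism induced by `coordRingToSquareZero` on the quotient by the parameters. -/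
noncomputable def paramQuotientToSquareZero : ParamQuotient n K →ₐ[K] SquareZeroRing n K :=
  Ideal.Quotient.liftₐ (paramIdeal n K) (coordRingToSquareZero n K) (by
    suffices paramIdeal n K ≤ RingHom.ker (coordRingToSquareZero n K) from fun a ha => this ha
    rw [Ideal.span_le]
    rintro _ ⟨s, rfl⟩
    simp [coordRingToSquareZero, RingHom.mem_ker])

theorem paramQuotientToSquareZero_mk (a : CoordRing n K) :
    paramQuotientToSquareZero n K (Ideal.Quotient.mk (paramIdeal n K) a) =
      coordRingToSquareZero n K a :=
  Ideal.Quotient.lift_mk (paramIdeal n K) _ _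

variable (n K) in
/-- The homomorphism sending the variables to the entries of the first row. -/
noncomputable def squareZeroToParamQuotient : SquareZeroRing n K →ₐ[K] ParamQuotient n K :=
  Ideal.Quotient.liftₐ _ (aeval fun j => Ideal.Quotient.mk (paramIdeal n K) (rowBar n K j)) (by
    set φ : MvPolynomial {j : Fin n // j ≠ 0} K →ₐ[K] ParamQuotient n K :=
      aeval fun j => Ideal.Quotient.mk (paramIdeal n K) (rowBar n K j)
    suffices Ideal.span (Set.range fun j : {j : Fin n // j ≠ 0} =>
        (X j ^ 2 : MvPolynomial {j : Fin n // j ≠ 0} K)) ≤ RingHom.ker φ from fun a ha => this ha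
    rw [Ideal.span_le]
    rintro _ ⟨j, rfl⟩
    simp [φ, RingHom.mem_ker, mk_rowBar_sq])

theorem squareZeroToParamQuotient_mk_X (j : {j : Fin n // j ≠ 0}) :
    squareZeroToParamQuotient n K (Ideal.Quotient.mk _ (X j)) =
      Ideal.Quotient.mk (paramIdeal n K) (rowBar n K j) :=
  (Ideal.Quotient.lift_mk _ _ _).trans (aeval_X _ _)

variable (n K) in
/-- The quotient by the parameters is the polynomial ring modulo the squares of the variables. -/
noncomputable def paramQuotientEquiv : ParamQuotient n K ≃ₐ[K] SquareZeroRing n K :=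
  AlgEquiv.ofAlgHom (paramQuotientToSquareZero n K) (squareZeroToParamQuotient n K)
    (Ideal.Quotient.algHom_ext _ (algHom_ext fun j => by
      change paramQuotientToSquareZero n K
        (squareZeroToParamQuotient n K (Ideal.Quotient.mk _ (X j))) = Ideal.Quotient.mk _ (X j)
      rw [squareZeroToParamQuotient_mk_X, paramQuotientToSquareZero_mk,
        coordRingToSquareZero_rowBar]))
    (by
      have h : (squareZeroToParamQuotient n K).comp (coordRingToSquareZero n K) =
          Ideal.Quotient.mkₐ K (paramIdeal n K) := by
        refine coordRing_algHom_ext (S := ParamQuotient n K) (fun s => ?_) fun j => ?_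
        · rw [AlgHom.comp_apply, coordRingToSquareZero, pointHom_paramBar, Pi.zero_apply, map_zero]
          exact (mk_paramBar s).symm
        · change squareZeroToParamQuotient n K (coordRingToSquareZero n K (rowBar n K j)) =
            Ideal.Quotient.mk (paramIdeal n K) (rowBar n K j)
          rw [coordRingToSquareZero_rowBar, squareZeroToParamQuotient_mk_X]
      refine AlgHom.ext fun a => ?_
      obtain ⟨a, rfl⟩ := Ideal.Quotient.mk_surjective a
      rw [AlgHom.comp_apply, paramQuotientToSquareZero_mk]
      exact DFunLike.congr_fun h a)

theorem paramQuotientEquiv_mk_matX (j : {j : Fin n // j ≠ 0}) :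
    paramQuotientEquiv n K
        (Ideal.Quotient.mk (paramIdeal n K) (Ideal.Quotient.mk _ (matX n K 0 j.1))) =
      Ideal.Quotient.mk _ (X j) :=
  (paramQuotientToSquareZero_mk _).trans (coordRingToSquareZero_rowBar j)

variable (n K) in
theorem ringKrullDim_squareZeroRing : ringKrullDim (SquareZeroRing n K) = 0 := by
  have : Nontrivial (SquareZeroRing n K) := by
    refine Ideal.Quotient.nontrivial_iff.mpr fun h => ?_
    have hle : Ideal.span (Set.range fun j : {j : Fin n // j ≠ 0} =>
        (X j ^ 2 : MvPolynomial {j : Fin n // j ≠ 0} K)) ≤ RingHom.ker constantCoeff := by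
      rw [Ideal.span_le]
      rintro _ ⟨j, rfl⟩
      simp [RingHom.mem_ker]
    rw [h, top_le_iff] at hle
    exact RingHom.ker_ne_top _ hle
  -- The squares of the variables are univariate monic equations over `K`; finiteness over a field
  -- makes the ring Artinian.
  have : Module.Finite K (SquareZeroRing n K) := by
    have h := (free_and_finite_quotient_univariateIdeal
      (fun _ : {j : Fin n // j ≠ 0} => (Polynomial.X ^ 2 : Polynomial K))
      fun _ => Polynomial.monic_X_pow 2).2
    have hI : univariateIdeal (fun _ : {j : Fin n // j ≠ 0} => (Polynomial.X ^ 2 : Polynomial K)) =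
        Ideal.span (Set.range fun j => X j ^ 2) := by simp [univariateIdeal]
    exact .equiv (Ideal.quotientEquivAlgOfEq K hI).toLinearEquiv
  have : IsArtinianRing (SquareZeroRing n K) := isArtinian_of_tower K inferInstance
  exact ringKrullDimZero_iff_ringKrullDim_eq_zero.mp inferInstance

variable (n K) in
theorem isHomogeneousSOP_paramBar : IsHomogeneousSOP (grading n K) (paramBar n K) where
  homogeneous s := ⟨1, one_pos, paramBar_mem_grading s⟩
  card_eq_dim := ringKrullDim_coordRing n K
  quotient_dim := (ringKrullDim_eq_of_ringEquiv (paramQuotientEquiv n K).toRingEquiv).trans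
    (ringKrullDim_squareZeroRing n K)

end CommDiag

theorem mainTheorem7 {K : Type*} [Field K] {n : ℕ} [NeZero n] (hn : 3 ≤ n) :
    CommDiag.IsHomogeneousSOP (CommDiag.grading n K) (CommDiag.paramBar n K) ∧
    CommDiag.IsRegularFamily (CommDiag.CoordRing n K) (CommDiag.paramBar n K) ∧
    ∃ e : CommDiag.ParamQuotient n K ≃ₐ[K] CommDiag.SquareZeroRing n K,
      ∀ j : {j : Fin n // j ≠ 0},
        e (Ideal.Quotient.mk _ (Ideal.Quotient.mk _ (CommDiag.matX n K 0 j.1))) =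
          Ideal.Quotient.mk _ (MvPolynomial.X j) :=
  ⟨CommDiag.isHomogeneousSOP_paramBar n K, CommDiag.isRegularFamily_paramBar n K,
    CommDiag.paramQuotientEquiv n K, CommDiag.paramQuotientEquiv_mk_matX⟩
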